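/- Let $R$ be a commutative unital ring and let $A$ be a unital associative $R$-algebra which is $2$-torsion free ($2a=0$ implies $a=0$). Let $e\in A$ be a nontrivial idempotent ($e^2=e$, $e\neq 0,1$) and put $f=1-e$. Suppose that for every $a\in A$ $$eae\cdot eAf=\{0\}\ \Rightarrow\ eae=0,\qquad eAf\cdot faf=\{0\}\ \Rightarrow\ faf=0 .$$ Regard $eAe$ and $fAf$ as rings with identities $e$ and $f$, and write $Z(\cdot)$ for the center. For $(p,q)\in\{(e,f),(f,e)\}$, the $(pAp,qAq)$-bimodule $pAq$ is called strongly faithful if either * it is faithful as a right $qAq$-module ($pAq\cdot b=\{0\}$ with $b\in qAq$ implies $b=0$) and, for all $a\in pAp$, $m\in pAq$, $am=0$ implies $a=0$ or $m=0$; or * it is faithful as a left $pAp$-module ($a\cdot pAq=\{0\}$ with $a\in pAp$ implies $a=0$) and, for all $m\in pAq$, $b\in qAq$, $mb=0$ implies $m=0$ or $b=0$. Assume that (I) $Z(fAf)=Z(A)f$ and $Z(eAe)=Z(A)e$; and (II) at least one of the following holds: * (i) at least one of the rings $eAe$, $fAf$ contains no nonzero two-sided ideal that lies in its center; * (ii)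 neither $eAe$ nor $fAf$ has zero divisors ($xy=0$ implies $x=0$ or $y=0$); * (iii) at least one of the bimodules $eAf$, $fAe$ is strongly faithful. Then $A$ has the Lie higher derivation (LHD) property: every Lie higher derivation of $A$ is proper. That is, let $(L_k)_{k\ge 0}$ be any sequence of $R$-linear maps $A\to A$ with $L_0=\mathrm{id}_A$ and $$L_k([x,y])=\sum_{i+j=k}[L_i(x),L_j(y)]\qquad(x,y\in A,\ k\ge 0),$$ where $[x,y]=xy-yx$. Then there are a higher derivation $(D_k)_{k\ge 0}$ of $A$ (i.e. $R$-linear maps with $D_0=\mathrm{id}_A$ and $D_k(xy)=\sum_{i+j=k}D_i(x)D_j(y)$ for all $x,y\in A$, $k\ge 0$) and $R$-linear maps $\tau_k:A\to A$ $(k\ge 1)$ with $\tau_k(A)\subseteq Z(A)$ and $\tau_k([x,y])=0$ for all $x,y\in A$, such that $L_k=D_k+\tau_k$ for all $k\ge 1$. -/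

import Mathlib

section HigherDerivations

variable {R A : Type*} [CommRing R] [Ring A] [Algebra R A]

/-- A higher derivation: a sequence `D₀ = id, D₁, D₂, …` of linear maps with
`Dₖ (xy) = ∑_{i+j=k} Dᵢ(x) Dⱼ(y)` for all `k`. -/
def IsHigherDerivation (D : ℕ → A →ₗ[R] A) : Prop :=
  D 0 = LinearMap.id ∧
    ∀ (k : ℕ) (x y : A), D k (x * y) = ∑ p ∈ Finset.HasAntidiagonal.antidiagonal k, D p.1 x * D p.2 y

/-- A Lie higher derivation: a sequence `L₀ = id, L₁, L₂, …` of linear maps with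
`Lₖ [x,y] = ∑_{i+j=k} [Lᵢ(x), Lⱼ(y)]` for all `k`, where `⁅x, y⁆ = x * y - y * x`. -/
def IsLieHigherDerivation (L : ℕ → A →ₗ[R] A) : Prop :=
  L 0 = LinearMap.id ∧
    ∀ (k : ℕ) (x y : A), L k ⁅x, y⁆ = ∑ p ∈ Finset.HasAntidiagonal.antidiagonal k, ⁅L p.1 x, L p.2 y⁆

/-- `L` is of the form `D + τ`, with `D` a higher derivation and `τ = (τₖ)_{k ≥ 1}` a sequence of
center valued linear maps vanishing at commutators (the value `τ 0` plays no role). -/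
def IsProperLieHigherDerivation (L : ℕ → A →ₗ[R] A) : Prop :=
  IsLieHigherDerivation L ∧
    ∃ D τ : ℕ → A →ₗ[R] A, IsHigherDerivation D ∧
      (∀ k, 1 ≤ k → ∀ x : A, τ k x ∈ Set.center A) ∧
      (∀ k, 1 ≤ k → ∀ x y : A, τ k ⁅x, y⁆ = 0) ∧
      (∀ k, 1 ≤ k → L k = D k + τ k)

variable (R A) in
/-- The Lie higher derivation (LHD) property of the `R`-algebra `A`. -/
def HasLHDProperty : Prop :=
  ∀ L : ℕ → A →ₗ[R] A, IsLieHigherDerivation L → IsProperLieHigherDerivation L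

end HigherDerivations

section Peirce

variable {A : Type*} [Ring A]

/-- The Peirce component `p A q`. -/
def peirceComponent (p q : A) : Set A := {x | ∃ a : A, x = p * a * q}

/-- The `(pAp, qAq)`-bimodule `pAq` is faithful as a left `pAp`-module. -/
def PeirceLeftFaithful (p q : A) : Prop :=
  ∀ a ∈ peirceComponent p p, (∀ m ∈ peirceComponent p q, a * m = 0) → a = 0

/-- The `(pAp, qAq)`-bimodule `pAq` is faithful as a right `qAq`-module. -/
def PeirceRightFaithful (p q : A) : Prop :=
  ∀ b ∈ peirceComponent q q, (∀ m ∈ peirceComponent p q, m * b = 0) → b = 0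

/-- The `(pAp, qAq)`-bimodule `pAq` is strongly faithful. -/
def PeirceStronglyFaithful (p q : A) : Prop :=
  (PeirceRightFaithful p q ∧
      ∀ a ∈ peirceComponent p p, ∀ m ∈ peirceComponent p q, a * m = 0 → a = 0 ∨ m = 0) ∨
    (PeirceLeftFaithful p q ∧
      ∀ m ∈ peirceComponent p q, ∀ b ∈ peirceComponent q q, m * b = 0 → m = 0 ∨ b = 0)

/-- The ring `S` contains no nonzero central (two-sided) ideal. -/
def NoNonzeroCentralIdeal (S : Type*) [Ring S] : Prop :=
  ∀ I : TwoSidedIdeal S, (∀ x ∈ I, x ∈ Set.center S) → I = ⊥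

/-- The inclusion of the ring `eAe` (with identity `e`) into `A`. -/
def cornerInclusion {e : A} (he : IsIdempotentElem e) (c : he.Corner) : A := c.1

/-- `Z(eAe) = Z(A)e`, as subsets of `A`. -/
def CornerCenterEq {e : A} (he : IsIdempotentElem e) : Prop :=
  cornerInclusion he '' Set.center he.Corner = {x : A | ∃ z ∈ Set.center A, x = z * e}

end Peirce

/-! Write f = 1 - e. The series Φ(x) = ∑ Lₖ(x) Xᵏ turns the sequence L into one Lie homomorphism A →
A⟦X⟧ congruent to the identity modulo X. Higher derivations correspond to multiplicative maps of
this kind, so the goal becomes Φ = D + T with D multiplicative and T central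
(`IsLieHigherDerivation.isProper`).

After conjugation by a unit congruent to 1, Φ(e) is block diagonal (`exists_conj_block_diagonal`).
The eigenvalues 0, 1, -1 of ad e then force Φ to respect the Peirce blocks
(`isBlockLieHom_of_map_left`). Commuting of eAe with fAf makes the f-corner of Φ(eAe) central in
fAf, coefficient by coefficient. Since Z(fAf) = Z(A)f, it comes from the center of A⟦X⟧, and the
same holds with e and f exchanged. Subtracting these central parts leaves a block preserving D
(`IsBlockLieHom.exists_decomposition`).

Faithfulness of eAf makes D multiplicative except on products of eAf with fAe, where the defect is
T([m,n]). Its lowest coefficient c is central, kills m and n, and ce, cf generate central ideals of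
the corners. Each alternative in (II) gives c = 0 (`obstruction_vanishes`). Undoing the conjugation
keeps D multiplicative and does not move T. -/

section LowestCoefficient

/-! ### Power series arguments through the lowest nonzero coefficient. -/

open PowerSeries

variable {A : Type*} [Ring A]

/-- If `x` has order at least `j`, the `j`-th coefficient of `x * y` is the product of the `j`-th
coefficient of `x` with the constant coefficient of `y`. -/
lemma coeff_mul_of_forall_lt_left {x : A⟦X⟧} (y : A⟦X⟧) {j : ℕ} (h : ∀ i < j, coeff i x = 0) :
    coeff j (x * y) = coeff j x * coeff 0 y := by
  rw [coeff_mul, Finset.sum_eq_single (j, 0)]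
  · rintro ⟨a, b⟩ hab hne
    rw [Finset.HasAntidiagonal.mem_antidiagonal] at hab
    have : a < j := by
      refine lt_of_le_of_ne (by simp at hab; omega) fun h' => hne ?_
      simp at hab ⊢; omega
    simp [h a this]
  · simp

lemma coeff_mul_of_forall_lt_right {x : A⟦X⟧} (y : A⟦X⟧) {j : ℕ} (h : ∀ i < j, coeff i x = 0) :
    coeff j (y * x) = coeff 0 y * coeff j x := by
  rw [coeff_mul, Finset.sum_eq_single (0, j)]
  · rintro ⟨a, b⟩ hab hne
    rw [Finset.HasAntidiagonal.mem_antidiagonal] at hab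
    have : b < j := by
      refine lt_of_le_of_ne (by simp at hab; omega) fun h' => hne ?_
      simp at hab ⊢; omega
    simp [h b this]
  · simp

lemma coeff_zero_mul_eq (x y : A⟦X⟧) : coeff 0 (x * y) = coeff 0 x * coeff 0 y :=
  coeff_mul_of_forall_lt_left y (by simp)

/-- Strong induction, phrased so that each step supplies the order hypothesis of
`coeff_mul_of_forall_lt_left`. Identities over A⟦X⟧ thus reduce to identities in A. -/
lemma powerSeries_eq_zero_of_lowest {x : A⟦X⟧}
    (h : ∀ j, (∀ i < j, coeff i x = 0) → coeff j x = 0) : x = 0 := by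
  ext n
  rw [map_zero]
  induction n using Nat.strong_induction_on with
  | _ n ih => exact h n ih

lemma coeff_mem_center {x : A⟦X⟧} (hx : x ∈ Set.center A⟦X⟧) (n : ℕ) :
    coeff n x ∈ Set.center A := by
  rw [Semigroup.mem_center_iff] at hx ⊢
  intro a
  have := congrArg (coeff n) (hx (C a))
  rwa [coeff_C_mul, coeff_mul_C] at this

lemma mem_center_of_coeff {x : A⟦X⟧} (hx : ∀ n, coeff n x ∈ Set.center A) :
    x ∈ Set.center A⟦X⟧ := by
  rw [Semigroup.mem_center_iff]
  intro y
  ext n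
  rw [coeff_mul, coeff_mul, ← Finset.Nat.sum_antidiagonal_swap]
  exact Finset.sum_congr rfl fun p _ => Semigroup.mem_center_iff.1 (hx _) _

/-- A self-map of power series whose `j`-th output coefficient depends only on the input
coefficients of index `< j` has a fixed point. -/
lemma exists_fixedPoint_of_contracting (G : A⟦X⟧ → A⟦X⟧)
    (hG : ∀ x y j, (∀ i < j, coeff i x = coeff i y) → coeff j (G x) = coeff j (G y)) :
    ∃ p, G p = p := by
  have step : ∀ n, ∀ i < n, coeff i (G^[n] 0) = coeff i (G^[n + 1] 0) := by
    intro n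
    induction n with
    | zero => simp
    | succ n ih =>
      intro i hi
      rw [Function.iterate_succ_apply', Function.iterate_succ_apply' G (n + 1)]
      exact hG _ _ _ fun k hk => ih k (by omega)
  have stable : ∀ i d, coeff i (G^[i + 1] 0) = coeff i (G^[i + 1 + d] 0) := by
    intro i d
    induction d with
    | zero => rfl
    | succ d ih => rw [ih]; exact step _ _ (by omega)
  -- Iterates n and n + 1 agree only below index n, so the coefficient of index n is final from
  -- iterate n + 1 on.
  refine ⟨mk fun n => coeff n (G^[n + 1] 0), ?_⟩
  ext j
  rw [coeff_mk, Function.iterate_succ_apply']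
  refine hG _ _ _ fun i hi => ?_
  rw [coeff_mk, stable i (j - (i + 1))]
  congr 2
  omega

end LowestCoefficient

/-! ### Block diagonalization of a deformed idempotent. -/

section BlockDiagonalization

open PowerSeries

variable {A : Type*} [Ring A] {e f : A}

/-- The Riccati equation that removes the `(e, f)`-block by a unipotent conjugation. -/
lemma exists_unipotent_upper_block (he : e * e = e) (hf : f * f = f) (hef : e * f = 0)
    (hfe : f * e = 0) (x : A⟦X⟧) (hx : coeff 0 x = e) :
    ∃ p : A⟦X⟧, C e * p = p ∧ p * C f = p ∧ coeff 0 p = 0 ∧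
      C e * ((1 + p) * x * (1 - p)) * C f = 0 := by
  have hE : (C e * C e : A⟦X⟧) = C e := by rw [← map_mul, he]
  have hF : (C f * C f : A⟦X⟧) = C f := by rw [← map_mul, hf]
  have hx0 : coeff 0 (C f * x * C e) = 0 := by rw [coeff_mul_C, coeff_C_mul, hx, hfe, zero_mul]
  have hx1 : e * coeff 0 (x - 1) = 0 := by simp only [map_sub, hx, mul_sub, he]; simp
  -- For p = epf, the (e,f)-block of (1+p)x(1-p) is exf - exp + pxf - pxp. Adding p to it gives this
  -- map, so its fixed points are the solutions. The quadratic term is written with fxe, whose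
  -- constant coefficient is 0, so that the map is contracting for every p, not only for p in the
  -- block.
  obtain ⟨p, hp⟩ := exists_fixedPoint_of_contracting
    (fun p => C e * (x - (x - 1) * p + p * x - p * (C f * x * C e) * p) * C f) (by
      intro p q j h
      set d := p - q with hd
      have hd0 : ∀ i < j, coeff i d = 0 := fun i hi => by rw [hd, map_sub, h i hi, sub_self]
      have key : C e * (x - (x - 1) * p + p * x - p * (C f * x * C e) * p) * C f
          = C e * (x - (x - 1) * q + q * x - q * (C f * x * C e) * q) * C f
          + C e * (-((x - 1) * d) + d * x - d * ((C f * x * C e) * p)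
            - (q * (C f * x * C e)) * d) * C f := by
        rw [hd]; noncomm_ring
      rw [key, map_add, add_eq_left, coeff_mul_C, coeff_C_mul, map_sub, map_sub, map_add, map_neg,
        coeff_mul_of_forall_lt_right _ hd0, coeff_mul_of_forall_lt_left _ hd0,
        coeff_mul_of_forall_lt_left _ hd0, coeff_mul_of_forall_lt_right _ hd0,
        coeff_mul_of_forall_lt_left (x := C f * x * C e) (j := 0) _ (by simp),
        coeff_mul_of_forall_lt_right (x := C f * x * C e) (j := 0) _ (by simp), hx0, hx]
      have h1 : e * (coeff 0 (x - 1) * coeff j d) = 0 := by rw [← mul_assoc, hx1, zero_mul]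
      simp only [mul_zero, zero_mul, sub_zero, mul_add, mul_neg, h1, neg_zero, zero_add]
      rw [mul_assoc, mul_assoc, hef, mul_zero, mul_zero])
  have h1 : C e * p = p := by
    rw [← hp]; simp only [← mul_assoc, hE]
  have h2 : p * C f = p := by
    rw [← hp]; simp only [mul_assoc, hF]
  refine ⟨p, h1, h2, ?_, ?_⟩
  · rw [← hp, coeff_mul_C, coeff_C_mul, map_sub, map_add, map_sub,
      coeff_mul_of_forall_lt_right (x := p) (j := 0) _ (by simp),
      coeff_mul_of_forall_lt_right (x := p) (j := 0) _ (by simp),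
      coeff_mul_of_forall_lt_right (x := C f * x * C e) (j := 0) _ (by simp),
      coeff_mul_of_forall_lt_left (x := p) (j := 0) _ (by simp), hx0, hx]
    have h1 : e * (coeff 0 (x - 1) * coeff 0 p) = 0 := by rw [← mul_assoc, hx1, zero_mul]
    simp only [mul_zero, zero_mul, sub_zero, mul_add, mul_sub, h1, add_mul, he, hef, mul_assoc,
      add_zero]
  · have hp' : C e * x * C f - C e * x * p + p + p * x * C f - p * x * p = p := by
      have h3 : p * (C f * x * C e) * p = p * x * p := by
        calc _ = (p * C f) * x * (C e * p) := by noncomm_ring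
          _ = _ := by rw [h1, h2]
      calc _ = C e * x * C f - C e * x * (p * C f) + (C e * p) * C f + (C e * p) * x * C f
              - (C e * p) * x * (p * C f) := by simp only [h1, h2]
        _ = C e * (x - (x - 1) * p + p * x - p * x * p) * C f := by noncomm_ring
        _ = p := by rw [← h3]; exact hp
    calc C e * ((1 + p) * x * (1 - p)) * C f
        = C e * x * C f - C e * x * (p * C f) + (C e * p) * x * C f
          - (C e * p) * x * (p * C f) := by noncomm_ring
      _ = (C e * x * C f - C e * x * p + p + p * x * C f - p * x * p) - p := by
        rw [h1, h2]; abel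
      _ = 0 := by rw [hp', sub_self]

/-- A power series with constant coefficient the idempotent `e` can be block diagonalized. -/
lemma exists_conj_block_diagonal (he : e * e = e) (hf : f * f = f) (hef : e * f = 0)
    (hfe : f * e = 0) (h1 : e + f = 1) (x : A⟦X⟧) (hx : coeff 0 x = e) :
    ∃ u v : A⟦X⟧, u * v = 1 ∧ v * u = 1 ∧ coeff 0 u = 1 ∧ coeff 0 v = 1 ∧
      C e * (u * x * v) * C f = 0 ∧ C f * (u * x * v) * C e = 0 := by
  have hEF : (C e * C f : A⟦X⟧) = 0 := by rw [← map_mul, hef, map_zero]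
  have hFE : (C f * C e : A⟦X⟧) = 0 := by rw [← map_mul, hfe, map_zero]
  obtain ⟨p, hep, hpf, hp0, hp⟩ := exists_unipotent_upper_block he hf hef hfe x hx
  have hpp : p * p = 0 := by
    calc p * p = (p * C f) * (C e * p) := by rw [hep, hpf]
      _ = p * (C f * C e) * p := by noncomm_ring
      _ = 0 := by rw [hFE]; simp
  have hp0' : constantCoeff p = 0 := by rwa [← coeff_zero_eq_constantCoeff_apply]
  set y := (1 + p) * x * (1 - p) with hy
  have hy0 : coeff 0 y = e := by
    rw [hy, coeff_zero_mul_eq, coeff_zero_mul_eq]; simp [hx, hp0']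
  -- The series 1 - y has constant coefficient f, so the roles of e and f can be exchanged.
  -- Conjugation fixes 1, hence clearing a block of 1 - y clears that of y. Since q = fqe, the
  -- (e,f)-block already cleared stays zero.
  obtain ⟨q, hfq, hqe, hq0, hq⟩ := exists_unipotent_upper_block hf he hfe hef (1 - y)
    (by rw [map_sub, hy0, coeff_zero_one, ← h1, add_sub_cancel_left])
  have hq0' : constantCoeff q = 0 := by rwa [← coeff_zero_eq_constantCoeff_apply]
  have hqq : q * q = 0 := by
    calc q * q = (q * C e) * (C f * q) := by rw [hfq, hqe]
      _ = q * (C e * C f) * q := by noncomm_ring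
      _ = 0 := by rw [hEF]; simp
  have hq1 : (1 + q) * (1 - q) = 1 := by
    calc (1 + q) * (1 - q) = 1 - q * q := by noncomm_ring
      _ = 1 := by rw [hqq, sub_zero]
  have hq2 : (1 - q) * (1 + q) = 1 := by
    calc (1 - q) * (1 + q) = 1 - q * q := by noncomm_ring
      _ = 1 := by rw [hqq, sub_zero]
  have hp1 : (1 + p) * (1 - p) = 1 := by
    calc (1 + p) * (1 - p) = 1 - p * p := by noncomm_ring
      _ = 1 := by rw [hpp, sub_zero]
  have hp2 : (1 - p) * (1 + p) = 1 := by
    calc (1 - p) * (1 + p) = 1 - p * p := by noncomm_ring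
      _ = 1 := by rw [hpp, sub_zero]
  have hconj : (1 + q) * (1 + p) * x * ((1 - p) * (1 - q)) = (1 + q) * y * (1 - q) := by
    rw [hy]; noncomm_ring
  refine ⟨(1 + q) * (1 + p), (1 - p) * (1 - q), ?_, ?_, ?_, ?_, ?_, ?_⟩
  · calc _ = (1 + q) * ((1 + p) * (1 - p)) * (1 - q) := by simp only [mul_assoc]
      _ = 1 := by rw [hp1, mul_one, hq1]
  · calc _ = (1 - p) * ((1 - q) * (1 + q)) * (1 + p) := by simp only [mul_assoc]
      _ = 1 := by rw [hq2, mul_one, hp2]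
  · rw [coeff_zero_mul_eq]; simp [hp0', hq0']
  · rw [coeff_zero_mul_eq]; simp [hp0', hq0']
  · rw [hconj]
    have heq : C e * q = 0 := by rw [← hfq, ← mul_assoc, hEF, zero_mul]
    have hqf : q * C f = 0 := by rw [← hqe, mul_assoc, hEF, mul_zero]
    calc C e * ((1 + q) * y * (1 - q)) * C f
        = C e * y * C f - C e * y * (q * C f) + (C e * q) * (y * (1 - q) * C f) := by noncomm_ring
      _ = 0 := by rw [hp, hqf, heq]; simp
  · rw [hconj]
    have : C f * ((1 + q) * (1 - q)) * C e = 0 := by rw [hq1, mul_one, hFE]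
    calc C f * ((1 + q) * y * (1 - q)) * C e
        = C f * ((1 + q) * (1 - q)) * C e - C f * ((1 + q) * (1 - y) * (1 - q)) * C e := by
          noncomm_ring
      _ = 0 := by rw [this, hq, sub_zero]

end BlockDiagonalization

/-! ### Peirce blocks and the eigenvalues of ad e. -/

section Blocks

open PowerSeries

/-- Two complementary orthogonal idempotents. -/
structure IsComplementaryPair {A : Type*} [Ring A] (e f : A) : Prop where
  left_idem : e * e = e
  right_idem : f * f = f
  mul_eq_zero : e * f = 0
  mul_eq_zero' : f * e = 0
  add_eq_one : e + f = 1

/-- `x` lies in the Peirce block `p A q` (for idempotents `p`, `q`). -/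
def InBlock {A : Type*} [Ring A] (p q x : A) : Prop := p * x = x ∧ x * q = x

variable {A : Type*} [Ring A] {e f p q r s x y : A}

lemma IsComplementaryPair.symm (h : IsComplementaryPair e f) : IsComplementaryPair f e :=
  ⟨h.2, h.1, h.4, h.3, by rw [add_comm, h.5]⟩

lemma IsComplementaryPair.map {B : Type*} [Ring B] (φ : A →+* B) (h : IsComplementaryPair e f) :
    IsComplementaryPair (φ e) (φ f) :=
  ⟨by rw [← map_mul, h.1], by rw [← map_mul, h.2], by rw [← map_mul, h.3, map_zero],
    by rw [← map_mul, h.4, map_zero], by rw [← map_add, h.5, map_one]⟩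

lemma InBlock.mul (hx : InBlock p q x) (hy : InBlock r s y) : InBlock p s (x * y) :=
  ⟨by rw [← mul_assoc, hx.1], by rw [mul_assoc, hy.2]⟩

lemma InBlock.sub (hx : InBlock p q x) (hy : InBlock p q y) : InBlock p q (x - y) :=
  ⟨by rw [mul_sub, hx.1, hy.1], by rw [sub_mul, hx.2, hy.2]⟩

lemma InBlock.mul_eq_zero (hx : InBlock p q x) (hy : InBlock r s y) (h : q * r = 0) :
    x * y = 0 := by
  rw [← hx.2, ← hy.1, mul_assoc, ← mul_assoc q, h, zero_mul, mul_zero]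

lemma InBlock.mul_left_eq_zero (hx : InBlock p q x) (h : r * p = 0) : r * x = 0 := by
  rw [← hx.1, ← mul_assoc, h, zero_mul]

lemma InBlock.mul_right_eq_zero (hx : InBlock p q x) (h : q * r = 0) : x * r = 0 := by
  rw [← hx.2, mul_assoc, h, mul_zero]

lemma inBlock_mul_mul (hp : p * p = p) (hq : q * q = q) (x : A) : InBlock p q (p * x * q) :=
  ⟨by rw [← mul_assoc, ← mul_assoc, hp], by rw [mul_assoc, hq]⟩

lemma InBlock.mul_mul (hx : InBlock p q x) : p * x * q = x := by rw [hx.1, hx.2]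

lemma InBlock.coeff {x : A⟦X⟧} (hx : InBlock (C p) (C q) x) (n : ℕ) :
    InBlock p q (PowerSeries.coeff n x) :=
  ⟨by rw [← coeff_C_mul, hx.1], by rw [← coeff_mul_C, hx.2]⟩

lemma IsComplementaryPair.decomp (h : IsComplementaryPair e f) (x : A) :
    x = e * x * e + e * x * f + (f * x * e + f * x * f) := by
  calc x = (e + f) * x * (e + f) := by rw [h.5, one_mul, mul_one]
    _ = _ := by noncomm_ring

/-- The relation `[w, y] = c y` forces a block of `y` to vanish as soon as the corresponding
relation for the constant coefficient `e` of `w` does. -/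
lemma block_eq_zero_of_commutator {w y : A⟦X⟧} (hw : coeff 0 w = e) (hp : p * p = p)
    (hq : q * q = q) (hwp : C p * w = w * C p) (hwq : C q * w = w * C q) (c : ℤ)
    (hy : w * y - y * w = c • y)
    (h : ∀ a, InBlock p q a → e * a - a * e = c • a → a = 0) : C p * y * C q = 0 := by
  have hP : (C p * C p : A⟦X⟧) = C p := by rw [← map_mul, hp]
  have hQ : (C q * C q : A⟦X⟧) = C q := by rw [← map_mul, hq]
  have hb := inBlock_mul_mul hP hQ y
  have hc : w * (C p * y * C q) - C p * y * C q * w = c • (C p * y * C q) := by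
    calc _ = (w * C p) * y * C q - C p * y * (C q * w) := by noncomm_ring
      _ = C p * (w * y - y * w) * C q := by rw [← hwp, hwq]; noncomm_ring
      _ = _ := by rw [hy, mul_smul_comm, smul_mul_assoc]
  refine powerSeries_eq_zero_of_lowest fun j hj => h _ (hb.coeff j) ?_
  have := congrArg (coeff j) hc
  rwa [map_sub, coeff_mul_of_forall_lt_left _ hj, coeff_mul_of_forall_lt_right _ hj, hw,
    map_zsmul] at this

end Blocks

/-! ### Lie homomorphisms into A⟦X⟧ that respect the Peirce blocks. -/

section LieHom

open PowerSeries

variable {R A : Type*} [CommRing R] [Ring A] [Algebra R A] {e f : A}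

/-- A Lie homomorphism `A → A⟦X⟧`, congruent to the identity modulo `X`, respecting the Peirce
blocks with respect to `e` and `f`. -/
structure IsBlockLieHom (e f : A) (Φ : A →ₗ[R] A⟦X⟧) : Prop where
  coeff_zero : ∀ x, coeff 0 (Φ x) = x
  map_lie : ∀ x y, Φ (x * y - y * x) = Φ x * Φ y - Φ y * Φ x
  diag : ∀ x, e * x = x * e → C e * Φ x * C f = 0 ∧ C f * Φ x * C e = 0
  upper : ∀ x, InBlock e f x → InBlock (C e) (C f) (Φ x)
  lower : ∀ x, InBlock f e x → InBlock (C f) (C e) (Φ x)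

/-- The operator ad e has eigenvalue 0 on the diagonal blocks, 1 on eAf and -1 on fAe. A relation
[e,x] = cx becomes [Φ e, Φ x] = c Φ x, and `block_eq_zero_of_commutator` removes every block of Φ x
with another eigenvalue. Separating 1 from -1 is where 2-torsion freeness enters. -/
lemma isBlockLieHom_of_map_left (h2 : ∀ a : A, (2 : ℕ) • a = 0 → a = 0)
    (h : IsComplementaryPair e f) (Φ : A →ₗ[R] A⟦X⟧) (h0 : ∀ x, coeff 0 (Φ x) = x)
    (hΦ : ∀ x y, Φ (x * y - y * x) = Φ x * Φ y - Φ y * Φ x)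
    (hef : C e * Φ e * C f = 0) (hfe : C f * Φ e * C e = 0) : IsBlockLieHom e f Φ := by
  have H := h.map (C : A →+* A⟦X⟧)
  have hwe : C e * Φ e = Φ e * C e := by
    calc C e * Φ e = C e * Φ e * (C e + C f) := by rw [H.5, mul_one]
      _ = (C e + C f) * Φ e * C e := by rw [mul_add, hef, add_zero, add_mul, add_mul, hfe, add_zero]
      _ = _ := by rw [H.5, one_mul]
  have hwf : C f * Φ e = Φ e * C f := by
    have : (C f : A⟦X⟧) = 1 - C e := by rw [← H.5, add_sub_cancel_left]
    rw [this, sub_mul, mul_sub, hwe, one_mul, mul_one]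
  have key : ∀ (x : A) (c : ℤ), e * x - x * e = c • x → Φ e * Φ x - Φ x * Φ e = c • Φ x := by
    intro x c hx
    rw [← hΦ, hx, map_zsmul]
  have hee : ∀ a, InBlock e e a → e * a - a * e = 0 := fun a ha => by rw [ha.1, ha.2, sub_self]
  have hff : ∀ a, InBlock f f a → e * a - a * e = 0 := fun a ha => by
    rw [ha.mul_left_eq_zero h.3, ha.mul_right_eq_zero h.4, sub_self]
  have heef : ∀ a, InBlock e f a → e * a - a * e = a := fun a ha => by
    rw [ha.1, ha.mul_right_eq_zero h.4, sub_zero]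
  have hffe : ∀ a, InBlock f e a → e * a - a * e = -a := fun a ha => by
    rw [ha.2, ha.mul_left_eq_zero h.3, zero_sub]
  refine ⟨h0, hΦ, ?_, ?_, ?_⟩
  · intro x hx
    have hk := key x 0 (by rw [hx, sub_self, zero_smul])
    refine ⟨block_eq_zero_of_commutator (h0 e) h.1 h.2 hwe hwf 0 hk fun a ha hc => ?_,
      block_eq_zero_of_commutator (h0 e) h.2 h.1 hwf hwe 0 hk fun a ha hc => ?_⟩
    · rwa [heef a ha, zero_smul] at hc
    · rwa [hffe a ha, zero_smul, neg_eq_zero] at hc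
  · intro x hx
    have hk := key x 1 (by rw [heef x hx, one_smul])
    have e1 := block_eq_zero_of_commutator (h0 e) h.1 h.1 hwe hwe 1 hk fun a ha hc => by
      rwa [hee a ha, one_smul, eq_comm] at hc
    have e2 := block_eq_zero_of_commutator (h0 e) h.2 h.2 hwf hwf 1 hk fun a ha hc => by
      rwa [hff a ha, one_smul, eq_comm] at hc
    have e3 := block_eq_zero_of_commutator (h0 e) h.2 h.1 hwf hwe 1 hk fun a ha hc => by
      rw [hffe a ha, one_smul] at hc
      apply h2
      rw [two_nsmul]
      nth_rewrite 1 [← hc]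
      exact neg_add_cancel a
    have := H.decomp (Φ x)
    rw [e1, e2, e3, zero_add, add_zero, add_zero] at this
    rw [this]
    exact inBlock_mul_mul H.1 H.2 _
  · intro x hx
    have hk := key x (-1) (by rw [hffe x hx, neg_one_smul])
    have e1 := block_eq_zero_of_commutator (h0 e) h.1 h.1 hwe hwe (-1) hk fun a ha hc => by
      rwa [hee a ha, neg_one_smul, eq_comm, neg_eq_zero] at hc
    have e2 := block_eq_zero_of_commutator (h0 e) h.2 h.2 hwf hwf (-1) hk fun a ha hc => by
      rwa [hff a ha, neg_one_smul, eq_comm, neg_eq_zero] at hc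
    have e3 := block_eq_zero_of_commutator (h0 e) h.1 h.2 hwe hwf (-1) hk fun a ha hc => by
      rw [heef a ha, neg_one_smul] at hc
      apply h2
      rw [two_nsmul]
      nth_rewrite 1 [hc]
      exact neg_add_cancel a
    have := H.decomp (Φ x)
    rw [e1, e2, e3, zero_add, zero_add, add_zero] at this
    rw [this]
    exact inBlock_mul_mul H.2 H.1 _

lemma IsBlockLieHom.symm (h : IsComplementaryPair e f) {Φ : A →ₗ[R] A⟦X⟧}
    (hΦ : IsBlockLieHom e f Φ) : IsBlockLieHom f e Φ := by
  refine ⟨hΦ.1, hΦ.2, fun x hx => (hΦ.diag x ?_).symm, hΦ.lower, hΦ.upper⟩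
  have : e = 1 - f := by rw [← h.5, add_sub_cancel_right]
  rw [this, sub_mul, mul_sub, hx, one_mul, mul_one]

end LieHom

/-! ### Central parts hidden in the opposite corners. -/

section CentralPart

open PowerSeries

variable {R A : Type*} [CommRing R] [Ring A] [Algebra R A] {e f : A}

lemma comm_of_mem_center {A : Type*} [Ring A] {z : A} (hz : z ∈ Set.center A) (x : A) :
    z * x = x * z :=
  (Semigroup.mem_center_iff.1 hz x).symm

lemma center_mul_injective_powerSeries (hinj : ∀ z ∈ Set.center A, z * f = 0 → z = 0)
    {z : A⟦X⟧} (hz : z ∈ Set.center A⟦X⟧) (h : z * C f = 0) : z = 0 := by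
  ext n
  rw [map_zero]
  refine hinj _ (coeff_mem_center hz n) ?_
  rw [← coeff_mul_C, h, map_zero]

/-- The `f`-corner of the image of `e A e` is central. -/
lemma IsBlockLieHom.exists_center_corner (h : IsComplementaryPair e f) {Φ : A →ₗ[R] A⟦X⟧}
    (hΦ : IsBlockLieHom e f Φ)
    (hZ : ∀ x, InBlock f f x → (∀ y, InBlock f f y → x * y = y * x) → ∃ z ∈ Set.center A, x = z * f)
    {x : A} (hx : InBlock e e x) :
    ∃ z ∈ Set.center A⟦X⟧, z * C f = C f * Φ x * C f := by
  have H := h.map (C : A →+* A⟦X⟧)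
  have hcomm : ∀ y, InBlock f f y →
      (C f * Φ x * C f) * (C f * Φ y * C f) = (C f * Φ y * C f) * (C f * Φ x * C f) := by
    intro y hy
    have h1 : Φ x * Φ y = Φ y * Φ x := by
      rw [← sub_eq_zero, ← hΦ.map_lie, hx.mul_eq_zero hy h.3, hy.mul_eq_zero hx h.4, sub_zero,
        map_zero]
    have hx' := (hΦ.diag x (by rw [hx.1, hx.2])).2
    have hy' := (hΦ.diag y
      (by rw [hy.mul_left_eq_zero h.3, hy.mul_right_eq_zero h.4])).2
    have aux : ∀ u v : A⟦X⟧, C f * u * C e = 0 →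
        (C f * u * C f) * (C f * v * C f) = C f * (u * v) * C f := by
      intro u v hu
      calc (C f * u * C f) * (C f * v * C f) = C f * u * (C f * C f) * v * C f := by
            noncomm_ring
        _ = C f * u * (C e + C f) * v * C f := by rw [H.2, mul_add, hu, zero_add]
        _ = C f * (u * v) * C f := by rw [H.5, mul_one]; noncomm_ring
    rw [aux _ _ hx', aux _ _ hy', h1]
  set g := C f * Φ x * C f with hg
  have hgb : InBlock (C f) (C f) g := inBlock_mul_mul H.2 H.2 _
  -- In the coefficient n of `hcomm`, every term other than (0, n) involves a lower coefficient of
  -- g, which commutes by induction. What remains is the commutation of `coeff n g` with the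
  -- constant coefficient of the corner of Φ y, which is y.
  have hcoeff : ∀ n, ∀ y, InBlock f f y → coeff n g * y = y * coeff n g := by
    intro n
    induction n using Nat.strong_induction_on with
    | _ n ih =>
      intro y hy
      have := congrArg (coeff n) (hcomm y hy)
      rw [coeff_mul, coeff_mul, ← Finset.Nat.sum_antidiagonal_swap] at this
      have hmem : (0, n) ∈ Finset.HasAntidiagonal.antidiagonal n := by simp
      rw [← Finset.add_sum_erase _ _ hmem, ← Finset.add_sum_erase _ _ hmem] at this
      have hrest : ∑ p ∈ (Finset.HasAntidiagonal.antidiagonal n).erase (0, n),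
            coeff p.swap.1 g * coeff p.swap.2 (C f * Φ y * C f)
          = ∑ p ∈ (Finset.HasAntidiagonal.antidiagonal n).erase (0, n),
            coeff p.1 (C f * Φ y * C f) * coeff p.2 g := by
        refine Finset.sum_congr rfl fun p hp => ?_
        rw [Finset.mem_erase, Finset.HasAntidiagonal.mem_antidiagonal] at hp
        obtain ⟨hp1, hp2⟩ := hp
        refine ih p.2 ?_ _ ((inBlock_mul_mul H.2 H.2 _).coeff _)
        refine lt_of_le_of_ne (by omega) fun hn => hp1 (Prod.ext ?_ hn)
        change p.1 = 0
        omega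
      rw [hrest] at this
      have := add_right_cancel this
      simpa only [Prod.swap, coeff_mul_C, coeff_C_mul, hΦ.coeff_zero, hy.mul_mul] using this
  choose z hz hzf using fun n => hZ _ (hgb.coeff n) (hcoeff n)
  refine ⟨PowerSeries.mk z, mem_center_of_coeff fun n => by rw [coeff_mk]; exact hz n, ?_⟩
  ext n
  rw [coeff_mul_C, coeff_mk, hzf]

/-- The central correction attached to the `f`-corners of the images of `e A e`. -/
lemma IsBlockLieHom.exists_central_part (h : IsComplementaryPair e f) {Φ : A →ₗ[R] A⟦X⟧}
    (hΦ : IsBlockLieHom e f Φ)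
    (hinj : ∀ z ∈ Set.center A, z * f = 0 → z = 0)
    (hZ : ∀ x, InBlock f f x → (∀ y, InBlock f f y → x * y = y * x) →
      ∃ z ∈ Set.center A, x = z * f) :
    ∃ S : A →ₗ[R] A⟦X⟧, (∀ x, S x ∈ Set.center A⟦X⟧) ∧
      ∀ x, S x * C f = C f * Φ (e * x * e) * C f := by
  choose S hS hSf using fun x => hΦ.exists_center_corner h hZ (inBlock_mul_mul h.1 h.1 x)
  have hmem : ∀ y, y ∈ Set.center A⟦X⟧ ↔ y ∈ Subalgebra.center R A⟦X⟧ := fun y => Iff.rfl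
  -- The pointwise choice is automatically linear: S x is central, hence determined by `S x * C f`,
  -- which is linear in x.
  refine ⟨⟨⟨S, fun x y => ?_⟩, fun r x => ?_⟩, hS, hSf⟩
  · rw [← sub_eq_zero]
    refine center_mul_injective_powerSeries hinj ?_ ?_
    · simp only [hmem] at hS ⊢
      exact sub_mem (hS _) (add_mem (hS _) (hS _))
    · rw [sub_mul, add_mul, hSf, hSf, hSf, mul_add, add_mul, map_add, mul_add, add_mul, sub_self]
  · rw [← sub_eq_zero]
    refine center_mul_injective_powerSeries hinj ?_ ?_
    · simp only [hmem] at hS ⊢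
      exact sub_mem (hS _) (Subalgebra.smul_mem _ (hS _) _)
    · simp only [sub_mul, RingHom.id_apply, smul_mul_assoc, hSf, mul_smul_comm, map_smul, sub_self]

end CentralPart

/-! ### Splitting off the central part, and multiplicativity of the remainder. -/

section Decomposition

open PowerSeries

variable {R A : Type*} [CommRing R] [Ring A] [Algebra R A] {e f : A}

/-- The Lie homomorphism `D + T`, with `D` block preserving and `T` central valued, vanishing on
the off-diagonal blocks. -/
structure IsBlockDecomposition (e f : A) (D T : A →ₗ[R] A⟦X⟧) : Prop where
  pair : IsComplementaryPair e f
  coeff_zero : ∀ x, coeff 0 (D x) = x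
  diag_left : ∀ x, InBlock e e x → InBlock (C e) (C e) (D x)
  diag_right : ∀ x, InBlock f f x → InBlock (C f) (C f) (D x)
  upper : ∀ x, InBlock e f x → InBlock (C e) (C f) (D x)
  lower : ∀ x, InBlock f e x → InBlock (C f) (C e) (D x)
  central : ∀ x, T x ∈ Set.center A⟦X⟧
  central_upper : ∀ x, InBlock e f x → T x = 0
  central_lower : ∀ x, InBlock f e x → T x = 0
  map_lie : ∀ x y, D (x * y - y * x) + T (x * y - y * x) = D x * D y - D y * D x

/-- Take T = S + S', where S removes the f-corner of the images of eAe and S' the e-corner of the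
images of fAf. Each correction vanishes on the other three blocks, and being central it leaves
brackets of images unchanged. -/
lemma IsBlockLieHom.exists_decomposition (h : IsComplementaryPair e f) {Φ : A →ₗ[R] A⟦X⟧}
    (hΦ : IsBlockLieHom e f Φ)
    (hinje : ∀ z ∈ Set.center A, z * e = 0 → z = 0)
    (hinjf : ∀ z ∈ Set.center A, z * f = 0 → z = 0)
    (hZe : ∀ x, InBlock e e x → (∀ y, InBlock e e y → x * y = y * x) →
      ∃ z ∈ Set.center A, x = z * e)
    (hZf : ∀ x, InBlock f f x → (∀ y, InBlock f f y → x * y = y * x) →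
      ∃ z ∈ Set.center A, x = z * f) :
    ∃ D T : A →ₗ[R] A⟦X⟧, IsBlockDecomposition e f D T ∧ Φ = D + T := by
  have H := h.map (C : A →+* A⟦X⟧)
  obtain ⟨S, hS, hSf⟩ := hΦ.exists_central_part h hinjf hZf
  obtain ⟨S', hS', hSe⟩ := (hΦ.symm h).exists_central_part h.symm hinje hZe
  have hmem : ∀ y, y ∈ Set.center A⟦X⟧ ↔ y ∈ Subalgebra.center R A⟦X⟧ := fun y => Iff.rfl
  have hT : ∀ x, (S + S') x ∈ Set.center A⟦X⟧ := fun x => by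
    rw [hmem, LinearMap.add_apply]
    exact add_mem ((hmem _).1 (hS x)) ((hmem _).1 (hS' x))
  have hS0 : ∀ x, e * x * e = 0 → S x = 0 := fun x hx => by
    refine center_mul_injective_powerSeries hinjf (hS x) ?_
    rw [hSf, hx, map_zero, mul_zero, zero_mul]
  have hS'0 : ∀ x, f * x * f = 0 → S' x = 0 := fun x hx => by
    refine center_mul_injective_powerSeries hinje (hS' x) ?_
    rw [hSe, hx, map_zero, mul_zero, zero_mul]
  have hup : ∀ x, InBlock e f x → S x = 0 ∧ S' x = 0 := fun x hx =>
    ⟨hS0 x (by rw [mul_assoc, hx.mul_right_eq_zero h.4, mul_zero]),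
      hS'0 x (by rw [hx.mul_left_eq_zero h.4, zero_mul])⟩
  have hlo : ∀ x, InBlock f e x → S x = 0 ∧ S' x = 0 := fun x hx =>
    ⟨hS0 x (by rw [hx.mul_left_eq_zero h.3, zero_mul]),
      hS'0 x (by rw [mul_assoc, hx.mul_right_eq_zero h.3, mul_zero])⟩
  have aux : ∀ z ∈ Set.center A⟦X⟧, ∀ u v : A⟦X⟧, u * z * v = z * (u * v) := fun z hz u v => by
    rw [← comm_of_mem_center hz u, mul_assoc]
  have hdl : ∀ x, InBlock e e x → InBlock (C e) (C e) (Φ x - S x) := fun x hx => by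
    obtain ⟨d1, d2⟩ := hΦ.diag x (by rw [hx.1, hx.2])
    have hd := H.decomp (Φ x - S x)
    have hf' := hSf x
    rw [hx.mul_mul] at hf'
    simp only [mul_sub, sub_mul, aux _ (hS x), H.3, H.4, d1, d2, H.2, hf', sub_self, mul_zero,
      add_zero] at hd
    have : Φ x - S x = C e * (Φ x - S x) * C e := by
      rw [mul_sub, sub_mul, aux _ (hS x)]; exact hd
    rw [this]; exact inBlock_mul_mul H.1 H.1 _
  have hdr : ∀ x, InBlock f f x → InBlock (C f) (C f) (Φ x - S' x) := fun x hx => by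
    obtain ⟨d1, d2⟩ := hΦ.diag x
      (by rw [hx.mul_left_eq_zero h.3, hx.mul_right_eq_zero h.4])
    have hd := H.decomp (Φ x - S' x)
    have hf' := hSe x
    rw [hx.mul_mul] at hf'
    simp only [mul_sub, sub_mul, aux _ (hS' x), H.3, H.4, d1, d2, H.1, hf', sub_self, mul_zero,
      zero_add] at hd
    have : Φ x - S' x = C f * (Φ x - S' x) * C f := by
      rw [mul_sub, sub_mul, aux _ (hS' x)]; exact hd
    rw [this]; exact inBlock_mul_mul H.2 H.2 _
  have hc1 : ∀ x, coeff 0 (S x) = 0 := fun x => by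
    refine hinjf _ (coeff_mem_center (hS x) 0) ?_
    rw [← coeff_mul_C, hSf, coeff_mul_C, coeff_C_mul, hΦ.coeff_zero]
    simp only [← mul_assoc, h.4, zero_mul]
  have hc2 : ∀ x, coeff 0 (S' x) = 0 := fun x => by
    refine hinje _ (coeff_mem_center (hS' x) 0) ?_
    rw [← coeff_mul_C, hSe, coeff_mul_C, coeff_C_mul, hΦ.coeff_zero]
    simp only [← mul_assoc, h.3, zero_mul]
  refine ⟨Φ - (S + S'), S + S', ⟨h, ?_, ?_, ?_, ?_, ?_, hT, ?_, ?_, ?_⟩, by abel⟩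
  · intro x
    rw [LinearMap.sub_apply, LinearMap.add_apply, map_sub, map_add, hc1, hc2, hΦ.coeff_zero]
    simp
  · intro x hx
    rw [LinearMap.sub_apply, LinearMap.add_apply,
      hS'0 x (by rw [hx.mul_left_eq_zero h.4, zero_mul]), add_zero]
    exact hdl x hx
  · intro x hx
    rw [LinearMap.sub_apply, LinearMap.add_apply,
      hS0 x (by rw [hx.mul_left_eq_zero h.3, zero_mul]), zero_add]
    exact hdr x hx
  · intro x hx
    rw [LinearMap.sub_apply, LinearMap.add_apply, (hup x hx).1, (hup x hx).2, add_zero, sub_zero]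
    exact hΦ.upper x hx
  · intro x hx
    rw [LinearMap.sub_apply, LinearMap.add_apply, (hlo x hx).1, (hlo x hx).2, add_zero, sub_zero]
    exact hΦ.lower x hx
  · intro x hx
    rw [LinearMap.add_apply, (hup x hx).1, (hup x hx).2, add_zero]
  · intro x hx
    rw [LinearMap.add_apply, (hlo x hx).1, (hlo x hx).2, add_zero]
  · intro x y
    rw [← LinearMap.add_apply, sub_add_cancel, hΦ.map_lie]
    set u := (S + S') x with hu
    set v := (S + S') y with hv
    have hcu := comm_of_mem_center (hT x) (Φ y)
    have hcv := comm_of_mem_center (hT y) (Φ x)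
    have hcuv := comm_of_mem_center (hT x) ((S + S') y)
    rw [← hu] at hcu hcuv
    rw [← hv] at hcv hcuv
    change _ = (Φ x - u) * (Φ y - v) - (Φ y - v) * (Φ x - u)
    simp only [sub_mul, mul_sub, hcu, hcv, hcuv]
    abel

namespace IsBlockDecomposition

variable {D T : A →ₗ[R] A⟦X⟧}

/-- When yx and its image vanish, the bracket relation is a product relation. This settles the four
products of a diagonal with an off-diagonal block. -/
lemma map_mul_of_mul_eq_zero (hD : IsBlockDecomposition e f D T) {x y : A} (hyx : y * x = 0)
    (hDyx : D y * D x = 0) (hT : T (x * y) = 0) : D (x * y) = D x * D y := by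
  have := hD.map_lie x y
  rwa [hyx, hDyx, sub_zero, sub_zero, hT, add_zero] at this

lemma map_mul_left_upper (hD : IsBlockDecomposition e f D T) {a m : A} (ha : InBlock e e a)
    (hm : InBlock e f m) : D (a * m) = D a * D m :=
  hD.map_mul_of_mul_eq_zero (hm.mul_eq_zero ha hD.pair.4)
    ((hD.upper m hm).mul_eq_zero (hD.diag_left a ha) (hD.pair.map C).4)
    (hD.central_upper _ (ha.mul hm))

lemma map_mul_upper_right (hD : IsBlockDecomposition e f D T) {m b : A} (hm : InBlock e f m)
    (hb : InBlock f f b) : D (m * b) = D m * D b :=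
  hD.map_mul_of_mul_eq_zero (hb.mul_eq_zero hm hD.pair.4)
    ((hD.diag_right b hb).mul_eq_zero (hD.upper m hm) (hD.pair.map C).4)
    (hD.central_upper _ (hm.mul hb))

lemma map_mul_right_lower (hD : IsBlockDecomposition e f D T) {b n : A} (hb : InBlock f f b)
    (hn : InBlock f e n) : D (b * n) = D b * D n :=
  hD.map_mul_of_mul_eq_zero (hn.mul_eq_zero hb hD.pair.3)
    ((hD.lower n hn).mul_eq_zero (hD.diag_right b hb) (hD.pair.map C).3)
    (hD.central_lower _ (hb.mul hn))

lemma map_mul_lower_left (hD : IsBlockDecomposition e f D T) {n a : A} (hn : InBlock f e n)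
    (ha : InBlock e e a) : D (n * a) = D n * D a :=
  hD.map_mul_of_mul_eq_zero (ha.mul_eq_zero hn hD.pair.3)
    ((hD.diag_left a ha).mul_eq_zero (hD.lower n hn) (hD.pair.map C).3)
    (hD.central_lower _ (hn.mul ha))

/-- Letting both sides act on D m for m in eAf, associativity shows that the defect kills D m. Its
lowest coefficient therefore kills m, and faithfulness applies. -/
lemma map_mul_left_left (hD : IsBlockDecomposition e f D T)
    (hl : ∀ a, InBlock e e a → (∀ m, InBlock e f m → a * m = 0) → a = 0)
    {a b : A} (ha : InBlock e e a) (hb : InBlock e e b) : D (a * b) = D a * D b := by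
  rw [← sub_eq_zero]
  have hblk : InBlock (C e) (C e) (D (a * b) - D a * D b) :=
    (hD.diag_left _ (ha.mul hb)).sub ((hD.diag_left _ ha).mul (hD.diag_left _ hb))
  refine powerSeries_eq_zero_of_lowest fun j hj => hl _ (hblk.coeff j) fun m hm => ?_
  rw [← hD.coeff_zero m, ← coeff_mul_of_forall_lt_left _ hj, sub_mul,
    ← hD.map_mul_left_upper (ha.mul hb) hm, mul_assoc (D a), ← hD.map_mul_left_upper hb hm,
    ← hD.map_mul_left_upper ha (hb.mul hm), mul_assoc, sub_self, map_zero]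

lemma map_mul_right_right (hD : IsBlockDecomposition e f D T)
    (hr : ∀ b, InBlock f f b → (∀ m, InBlock e f m → m * b = 0) → b = 0)
    {a b : A} (ha : InBlock f f a) (hb : InBlock f f b) : D (a * b) = D a * D b := by
  rw [← sub_eq_zero]
  have hblk : InBlock (C f) (C f) (D (a * b) - D a * D b) :=
    (hD.diag_right _ (ha.mul hb)).sub ((hD.diag_right _ ha).mul (hD.diag_right _ hb))
  refine powerSeries_eq_zero_of_lowest fun j hj => hr _ (hblk.coeff j) fun m hm => ?_
  rw [← hD.coeff_zero m, ← coeff_mul_of_forall_lt_right _ hj, mul_sub,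
    ← hD.map_mul_upper_right hm (ha.mul hb), ← mul_assoc (D m), ← hD.map_mul_upper_right hm ha,
    ← hD.map_mul_upper_right (hm.mul ha) hb, mul_assoc, sub_self, map_zero]

/-- The obstruction `T [m, n]` to `D` being multiplicative on `e A f` and `f A e`. -/
lemma upper_mul_lower (hD : IsBlockDecomposition e f D T) {m n : A} (hm : InBlock e f m)
    (hn : InBlock f e n) : D m * D n = D (m * n) + T (m * n - n * m) * C e := by
  have := congrArg (C e * ·) (hD.map_lie m n)
  have H := hD.pair.map (C : A →+* A⟦X⟧)
  simp only [mul_add, mul_sub, map_sub, (hD.diag_left _ (hm.mul hn)).1,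
    (hD.diag_right _ (hn.mul hm)).mul_left_eq_zero H.3,
    ((hD.upper _ hm).mul (hD.lower _ hn)).1,
    ((hD.lower _ hn).mul (hD.upper _ hm)).mul_left_eq_zero H.3, sub_zero] at this
  rw [← this, comm_of_mem_center (hD.central _), map_sub, mul_sub]

lemma lower_mul_upper (hD : IsBlockDecomposition e f D T) {m n : A} (hm : InBlock e f m)
    (hn : InBlock f e n) : D n * D m = D (n * m) - T (m * n - n * m) * C f := by
  have := congrArg (C f * ·) (hD.map_lie m n)
  have H := hD.pair.map (C : A →+* A⟦X⟧)
  simp only [mul_add, mul_sub, map_sub, (hD.diag_right _ (hn.mul hm)).1,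
    (hD.diag_left _ (hm.mul hn)).mul_left_eq_zero H.4,
    ((hD.lower _ hn).mul (hD.upper _ hm)).1,
    ((hD.upper _ hm).mul (hD.lower _ hn)).mul_left_eq_zero H.4, zero_sub] at this
  rw [comm_of_mem_center (hD.central _), map_sub, mul_sub, ← neg_neg (D n * D m), ← this]
  abel

/-- Compare the defects in D(am)D(n) = D(a)(D(m)D(n)). The outcome is that left multiples of the
obstruction by D(eAe) are again central multiples of e. -/
lemma obstruction_left (hD : IsBlockDecomposition e f D T)
    (hl : ∀ a, InBlock e e a → (∀ m, InBlock e f m → a * m = 0) → a = 0)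
    {a m n : A} (ha : InBlock e e a) (hm : InBlock e f m) (hn : InBlock f e n) :
    D a * (T (m * n - n * m) * C e) = T (a * m * n - n * (a * m)) * C e := by
  have h1 := hD.upper_mul_lower (ha.mul hm) hn
  rw [hD.map_mul_left_upper ha hm, mul_assoc, hD.upper_mul_lower hm hn, mul_assoc a,
    hD.map_mul_left_left hl ha (hm.mul hn), mul_add] at h1
  rw [mul_assoc a]
  exact add_left_cancel h1

lemma obstruction_right (hD : IsBlockDecomposition e f D T)
    (hr : ∀ b, InBlock f f b → (∀ m, InBlock e f m → m * b = 0) → b = 0)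
    {b m n : A} (hb : InBlock f f b) (hm : InBlock e f m) (hn : InBlock f e n) :
    T (m * n - n * m) * C f * D b = T (m * b * n - n * (m * b)) * C f := by
  have h1 := hD.lower_mul_upper (hm.mul hb) hn
  rw [hD.map_mul_upper_right hm hb, ← mul_assoc, hD.lower_mul_upper hm hn, ← mul_assoc n,
    hD.map_mul_right_right hr (hn.mul hm) hb, sub_mul] at h1
  rw [← mul_assoc n]
  exact sub_right_injective h1

/-- The two bracketings of D(m)D(n)D(m) produce the obstruction with opposite signs, so twice the
product is zero. -/
lemma obstruction_mul_upper (hD : IsBlockDecomposition e f D T)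
    (h2 : ∀ a : A, (2 : ℕ) • a = 0 → a = 0)
    {m n : A} (hm : InBlock e f m) (hn : InBlock f e n) : T (m * n - n * m) * D m = 0 := by
  have h1 : (D m * D n) * D m = D m * (D n * D m) := mul_assoc _ _ _
  have hcomm := comm_of_mem_center (hD.central (m * n - n * m)) (D m)
  rw [hD.upper_mul_lower hm hn, hD.lower_mul_upper hm hn, add_mul, mul_sub,
    ← hD.map_mul_left_upper (hm.mul hn) hm, ← hD.map_mul_upper_right hm (hn.mul hm), mul_assoc m,
    mul_assoc, (hD.upper m hm).1, ← mul_assoc (D m), ← hcomm, mul_assoc, (hD.upper m hm).2] at h1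
  ext k
  rw [map_zero]
  apply h2
  rw [← map_nsmul, two_nsmul]
  have h3 : T (m * n - n * m) * D m = - (T (m * n - n * m) * D m) :=
    add_left_cancel (h1.trans (sub_eq_add_neg _ _))
  nth_rewrite 1 [h3]
  rw [neg_add_cancel, map_zero]

lemma obstruction_mul_lower (hD : IsBlockDecomposition e f D T)
    (h2 : ∀ a : A, (2 : ℕ) • a = 0 → a = 0)
    {m n : A} (hm : InBlock e f m) (hn : InBlock f e n) : T (m * n - n * m) * D n = 0 := by
  have h1 : D n * (D m * D n) = (D n * D m) * D n := (mul_assoc _ _ _).symm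
  have hcomm := comm_of_mem_center (hD.central (m * n - n * m)) (D n)
  rw [hD.upper_mul_lower hm hn, hD.lower_mul_upper hm hn, mul_add, sub_mul,
    ← hD.map_mul_lower_left hn (hm.mul hn), ← hD.map_mul_right_lower (hn.mul hm) hn, mul_assoc n,
    mul_assoc (T _), (hD.lower n hn).1, ← mul_assoc (D n), ← hcomm, mul_assoc (T _),
    (hD.lower n hn).2] at h1
  ext k
  rw [map_zero]
  apply h2
  rw [← map_nsmul, two_nsmul]
  have h3 : T (m * n - n * m) * D n = - (T (m * n - n * m) * D n) :=
    add_left_cancel (h1.trans (sub_eq_add_neg _ _))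
  nth_rewrite 1 [h3]
  rw [neg_add_cancel, map_zero]

/-- The hypothesis `hobs` isolates what the alternatives in (II) must provide: c stands for the
lowest coefficient of the obstruction, and its premises are the traces in A of the preceding power
series identities. -/
lemma obstruction_eq_zero (hD : IsBlockDecomposition e f D T)
    (h2 : ∀ a : A, (2 : ℕ) • a = 0 → a = 0)
    (hl : ∀ a, InBlock e e a → (∀ m, InBlock e f m → a * m = 0) → a = 0)
    (hr : ∀ b, InBlock f f b → (∀ m, InBlock e f m → m * b = 0) → b = 0)
    (hobs : ∀ m n c, InBlock e f m → InBlock f e n → c ∈ Set.center A → c * m = 0 → c * n = 0 →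
      (∀ a, InBlock e e a → ∃ c' ∈ Set.center A, a * (c * e) = c' * e) →
      (∀ b, InBlock f f b → ∃ c' ∈ Set.center A, c * f * b = c' * f) →
      (m * n = 0 → n * m = 0 → c = 0) → c = 0)
    {m n : A} (hm : InBlock e f m) (hn : InBlock f e n) : T (m * n - n * m) = 0 := by
  have hupper := hD.obstruction_mul_upper h2 hm hn
  have hlower := hD.obstruction_mul_lower h2 hm hn
  have hleft := fun a (ha : InBlock e e a) => hD.obstruction_left hl ha hm hn
  have hright := fun b (hb : InBlock f f b) => hD.obstruction_right hr hb hm hn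
  refine powerSeries_eq_zero_of_lowest fun j hj => ?_
  refine hobs m n _ hm hn (coeff_mem_center (hD.central _) j) ?_ ?_ ?_ ?_ ?_
  · have := coeff_mul_of_forall_lt_left (D m) hj
    rwa [hupper, map_zero, hD.coeff_zero, eq_comm] at this
  · have := coeff_mul_of_forall_lt_left (D n) hj
    rwa [hlower, map_zero, hD.coeff_zero, eq_comm] at this
  · intro a ha
    refine ⟨_, coeff_mem_center (hD.central (a * m * n - n * (a * m))) j, ?_⟩
    have := congrArg (coeff j) (hleft a ha)
    rwa [← mul_assoc, coeff_mul_C, coeff_mul_C, coeff_mul_of_forall_lt_right _ hj, hD.coeff_zero,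
      mul_assoc] at this
  · intro b hb
    refine ⟨_, coeff_mem_center (hD.central (m * b * n - n * (m * b))) j, ?_⟩
    have := congrArg (coeff j) (hright b hb)
    rw [mul_assoc, (hD.diag_right b hb).1, coeff_mul_C, coeff_mul_of_forall_lt_left _ hj,
      hD.coeff_zero] at this
    rwa [mul_assoc, hb.1]
  · intro h1 h3
    rw [h1, h3, sub_zero, map_zero, map_zero]

/-- If the obstruction vanishes, `D` is multiplicative. -/
lemma map_mul (hD : IsBlockDecomposition e f D T)
    (hl : ∀ a, InBlock e e a → (∀ m, InBlock e f m → a * m = 0) → a = 0)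
    (hr : ∀ b, InBlock f f b → (∀ m, InBlock e f m → m * b = 0) → b = 0)
    (hT : ∀ m n, InBlock e f m → InBlock f e n → T (m * n - n * m) = 0) (x y : A) :
    D (x * y) = D x * D y := by
  have h := hD.pair
  have H := h.map (C : A →+* A⟦X⟧)
  have bee := fun x => inBlock_mul_mul h.1 h.1 x
  have bef := fun x => inBlock_mul_mul h.1 h.2 x
  have bfe := fun x => inBlock_mul_mul h.2 h.1 x
  have bff := fun x => inBlock_mul_mul h.2 h.2 x
  have hmn : ∀ m n, InBlock e f m → InBlock f e n → D (m * n) = D m * D n := fun m n hm hn => by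
    rw [hD.upper_mul_lower hm hn, hT m n hm hn, zero_mul, add_zero]
  have hnm : ∀ m n, InBlock e f m → InBlock f e n → D (n * m) = D n * D m := fun m n hm hn => by
    rw [hD.lower_mul_upper hm hn, hT m n hm hn, zero_mul, sub_zero]
  -- Of the sixteen block products, eight vanish by orthogonality both in A and after D, and the
  -- other eight are already known to be multiplicative.
  have key : ∀ a m n b a' m' n' b' : A, InBlock e e a → InBlock e f m → InBlock f e n →
      InBlock f f b → InBlock e e a' → InBlock e f m' → InBlock f e n' → InBlock f f b' →
      D ((a + m + (n + b)) * (a' + m' + (n' + b'))) =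
        D (a + m + (n + b)) * D (a' + m' + (n' + b')) := by
    intro a m n b a' m' n' b' ha hm hn hb ha' hm' hn' hb'
    have Ha := hD.diag_left a ha
    have Hm := hD.upper m hm
    have Hn := hD.lower n hn
    have Hb := hD.diag_right b hb
    have Ha' := hD.diag_left a' ha'
    have Hm' := hD.upper m' hm'
    have Hn' := hD.lower n' hn'
    have Hb' := hD.diag_right b' hb'
    simp only [add_mul, mul_add, map_add,
      ha.mul_eq_zero hn' h.3, ha.mul_eq_zero hb' h.3, hm.mul_eq_zero ha' h.4,
      hm.mul_eq_zero hm' h.4, hn.mul_eq_zero hn' h.3, hn.mul_eq_zero hb' h.3,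
      hb.mul_eq_zero ha' h.4, hb.mul_eq_zero hm' h.4,
      Ha.mul_eq_zero Hn' H.3, Ha.mul_eq_zero Hb' H.3, Hm.mul_eq_zero Ha' H.4,
      Hm.mul_eq_zero Hm' H.4, Hn.mul_eq_zero Hn' H.3, Hn.mul_eq_zero Hb' H.3,
      Hb.mul_eq_zero Ha' H.4, Hb.mul_eq_zero Hm' H.4,
      hD.map_mul_left_left hl ha ha', hD.map_mul_left_upper ha hm', hmn m n' hm hn',
      hD.map_mul_upper_right hm hb', hD.map_mul_lower_left hn ha', hnm m' n hm' hn,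
      hD.map_mul_right_lower hb hn', hD.map_mul_right_right hr hb hb', map_zero]
  rw [h.decomp x, h.decomp y]
  exact key _ _ _ _ _ _ _ _ (bee x) (bef x) (bfe x) (bff x) (bee y) (bef y) (bfe y) (bff y)

end IsBlockDecomposition

end Decomposition

/-! ### Passage between Peirce blocks and corner rings. -/

section Corner

variable {A : Type*} [Ring A] {e f : A}

lemma mem_peirceComponent_of_inBlock {p q x : A} (hx : InBlock p q x) :
    x ∈ peirceComponent p q :=
  ⟨x, hx.mul_mul.symm⟩

lemma inBlock_of_mem_peirceComponent {p q x : A} (hp : p * p = p) (hq : q * q = q)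
    (hx : x ∈ peirceComponent p q) : InBlock p q x := by
  obtain ⟨a, rfl⟩ := hx
  exact inBlock_mul_mul hp hq a

/-- The element of the corner ring given by an element of the block `e A e`. -/
def cornerOf (he : IsIdempotentElem e) {x : A} (hx : InBlock e e x) : he.Corner :=
  ⟨x, x, hx.mul_mul⟩

lemma inBlock_cornerInclusion (he : IsIdempotentElem e) (x : he.Corner) :
    InBlock e e (cornerInclusion he x) := by
  obtain ⟨_, a, rfl⟩ := x
  exact inBlock_mul_mul he he a

lemma corner_ext (he : IsIdempotentElem e) {x y : he.Corner}
    (h : cornerInclusion he x = cornerInclusion he y) : x = y :=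
  Subtype.ext h

lemma CornerCenterEq.exists_center {he : IsIdempotentElem e} (h : CornerCenterEq he) {x : A}
    (hx : InBlock e e x) (hc : ∀ y, InBlock e e y → x * y = y * x) :
    ∃ z ∈ Set.center A, x = z * e := by
  have : x ∈ cornerInclusion he '' Set.center he.Corner := by
    refine ⟨cornerOf he hx, Semigroup.mem_center_iff.2 fun y => corner_ext he ?_, rfl⟩
    exact (hc _ (inBlock_cornerInclusion he y)).symm
  rw [h] at this
  exact this

/-- An element of `e A e` generating a central left ideal vanishes if the corner ring has no
nonzero central ideal. -/
lemma eq_zero_of_noNonzeroCentralIdeal {he : IsIdempotentElem e}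
    (h : NoNonzeroCentralIdeal he.Corner) {x : A} (hx : InBlock e e x)
    (hc : ∀ a, InBlock e e a → ∃ c ∈ Set.center A, a * x = c * e) : x = 0 := by
  -- Elements all of whose left multiples are central. Taking a = 1 shows that they are central
  -- themselves, so right multiples are left multiples and the ideal is two-sided.
  let I : TwoSidedIdeal he.Corner := TwoSidedIdeal.mk' {y | ∀ a, a * y ∈ Subring.center he.Corner}
    (fun a => by rw [mul_zero]; exact zero_mem _)
    (fun {y z} hy hz a => by rw [mul_add]; exact add_mem (hy a) (hz a))
    (fun {y} hy a => by
      have h1 : a * -y = -(a * y) := mul_neg a y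
      rw [h1]; exact neg_mem (hy a))
    (fun {y z} hz a => by rw [← mul_assoc]; exact hz _)
    (fun {y z} hy a => by
      have h1 : y * z = z * y := by
        have := hy 1
        rw [one_mul, Subring.mem_center_iff] at this
        exact (this z).symm
      rw [h1, ← mul_assoc]; exact hy _)
  have hI : I = ⊥ := h I fun y hy => by
    have := (TwoSidedIdeal.mem_mk' _ _ _ _ _ _ _).1 hy 1
    rwa [one_mul] at this
  have hxI : cornerOf he hx ∈ I := by
    refine (TwoSidedIdeal.mem_mk' _ _ _ _ _ _ _).2 fun a => Subring.mem_center_iff.2 fun y =>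
      corner_ext he ?_
    obtain ⟨c, hcA, hce⟩ := hc _ (inBlock_cornerInclusion he a)
    have hy := inBlock_cornerInclusion he y
    change cornerInclusion he y * (cornerInclusion he a * x)
      = cornerInclusion he a * x * cornerInclusion he y
    rw [hce, mul_assoc, hy.1, ← mul_assoc, ← comm_of_mem_center hcA, mul_assoc, hy.2]
  rw [hI, TwoSidedIdeal.mem_bot] at hxI
  exact congrArg (cornerInclusion he) hxI

lemma mul_eq_zero_of_noZeroDivisors {he : IsIdempotentElem e} (h : NoZeroDivisors he.Corner)
    {x y : A} (hx : InBlock e e x) (hy : InBlock e e y) (hxy : x * y = 0) : x = 0 ∨ y = 0 := by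
  have : cornerOf he hx * cornerOf he hy = 0 := corner_ext he hxy
  rcases h.eq_zero_or_eq_zero_of_mul_eq_zero this with h | h
  · exact Or.inl (congrArg (cornerInclusion he) h)
  · exact Or.inr (congrArg (cornerInclusion he) h)

end Corner

/-! ### Generating series, the three alternatives, and the conclusion. -/

section Final

open PowerSeries

variable {R A : Type*} [CommRing R] [Ring A] [Algebra R A]

/-- The Lie homomorphism `x ↦ ∑ Lₖ(x) Xᵏ` attached to a sequence of linear maps. -/
noncomputable def generatingMap (L : ℕ → A →ₗ[R] A) : A →ₗ[R] A⟦X⟧ where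
  toFun x := PowerSeries.mk fun k => L k x
  map_add' x y := by ext k; simp
  map_smul' r x := by
    ext k
    have h : coeff k (r • PowerSeries.mk fun k => L k x)
        = r • coeff k (PowerSeries.mk fun k => L k x) := rfl
    rw [RingHom.id_apply, h, coeff_mk, coeff_mk, map_smul]

lemma coeff_generatingMap (L : ℕ → A →ₗ[R] A) (k : ℕ) (x : A) :
    coeff k (generatingMap L x) = L k x :=
  coeff_mk k fun k => L k x

/-- The coefficients of a linear map into power series. -/
noncomputable def coeffMap (D : A →ₗ[R] A⟦X⟧) (k : ℕ) : A →ₗ[R] A where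
  toFun x := coeff k (D x)
  map_add' x y := by rw [map_add, map_add]
  map_smul' r x := by
    rw [map_smul]
    rfl

lemma IsLieHigherDerivation.generatingMap_lie {L : ℕ → A →ₗ[R] A} (hL : IsLieHigherDerivation L)
    (x y : A) : generatingMap L (x * y - y * x) =
      generatingMap L x * generatingMap L y - generatingMap L y * generatingMap L x := by
  ext k
  rw [coeff_generatingMap, ← Ring.lie_def, hL.2, map_sub, coeff_mul, coeff_mul,
    ← Finset.Nat.sum_antidiagonal_swap (f := fun p => coeff p.1 (generatingMap L y) * _),
    ← Finset.sum_sub_distrib]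
  refine Finset.sum_congr rfl fun p _ => ?_
  simp only [coeff_generatingMap, Ring.lie_def, Prod.fst_swap, Prod.snd_swap]

/-- A Lie higher derivation whose generating map is the sum of a multiplicative map and a central
valued map is proper. -/
lemma IsLieHigherDerivation.isProper {L : ℕ → A →ₗ[R] A} (hL : IsLieHigherDerivation L)
    (D T : A →ₗ[R] A⟦X⟧) (hD0 : ∀ x, coeff 0 (D x) = x) (hD : ∀ x y, D (x * y) = D x * D y)
    (hT : ∀ x, T x ∈ Set.center A⟦X⟧) (hDT : ∀ x, generatingMap L x = D x + T x) :
    IsProperLieHigherDerivation L := by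
  -- Both D + T and D respect brackets, and adding central terms does not change a bracket of
  -- images.
  have hcomm : ∀ x y, T (x * y - y * x) = 0 := by
    intro x y
    have h1 := hL.generatingMap_lie x y
    rw [hDT, hDT, hDT, map_sub, hD, hD] at h1
    have h2 := comm_of_mem_center (hT x) (D y)
    have h3 := comm_of_mem_center (hT y) (D x)
    have h4 := comm_of_mem_center (hT x) (T y)
    simp only [add_mul, mul_add, h2, h3, h4] at h1
    have h5 : D x * D y - D y * D x + T (x * y - y * x) = D x * D y - D y * D x := by
      rw [h1]; abel
    exact add_eq_left.1 h5
  refine ⟨hL, coeffMap D, coeffMap T, ⟨LinearMap.ext hD0, fun k x y => ?_⟩,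
    fun k _ x => coeff_mem_center (hT x) k, fun k _ x y => ?_, fun k _ => LinearMap.ext fun x => ?_⟩
  · change coeff k (D (x * y)) = _
    rw [hD, coeff_mul]
    rfl
  · change coeff k (T _) = 0
    rw [Ring.lie_def, hcomm, map_zero]
  · rw [← coeff_generatingMap, hDT, map_add]
    rfl

/-- The conjugate of a linear map into power series. -/
noncomputable def conjMap (u v : A⟦X⟧) (Φ : A →ₗ[R] A⟦X⟧) : A →ₗ[R] A⟦X⟧ where
  toFun x := u * Φ x * v
  map_add' x y := by rw [map_add, mul_add, add_mul]
  map_smul' r x := by rw [map_smul, mul_smul_comm, smul_mul_assoc, RingHom.id_apply]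

lemma conjMap_apply (u v : A⟦X⟧) (Φ : A →ₗ[R] A⟦X⟧) (x : A) :
    conjMap u v Φ x = u * Φ x * v := rfl

/-- The vanishing of the obstruction under the three alternatives of the theorem. -/
lemma obstruction_vanishes {e : A} (he : IsIdempotentElem e)
    (hinje : ∀ z ∈ Set.center A, z * e = 0 → z = 0)
    (hinjf : ∀ z ∈ Set.center A, z * (1 - e) = 0 → z = 0)
    (hcases :
      (NoNonzeroCentralIdeal he.Corner ∨ NoNonzeroCentralIdeal he.one_sub.Corner) ∨
      (NoZeroDivisors he.Corner ∧ NoZeroDivisors he.one_sub.Corner) ∨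
      (PeirceStronglyFaithful e (1 - e) ∨ PeirceStronglyFaithful (1 - e) e))
    (m n c : A) (hm : InBlock e (1 - e) m) (hn : InBlock (1 - e) e n) (hc : c ∈ Set.center A)
    (hcm : c * m = 0) (hcn : c * n = 0)
    (hce : ∀ a, InBlock e e a → ∃ c' ∈ Set.center A, a * (c * e) = c' * e)
    (hcf : ∀ b, InBlock (1 - e) (1 - e) b →
      ∃ c' ∈ Set.center A, c * (1 - e) * b = c' * (1 - e))
    (h0 : m * n = 0 → n * m = 0 → c = 0) : c = 0 := by
  have hf := he.one_sub
  have hee : InBlock e e (c * e) :=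
    ⟨by rw [← mul_assoc, ← comm_of_mem_center hc, mul_assoc, he.eq], by rw [mul_assoc, he.eq]⟩
  have hff : InBlock (1 - e) (1 - e) (c * (1 - e)) :=
    ⟨by rw [← mul_assoc, ← comm_of_mem_center hc, mul_assoc, hf.eq], by rw [mul_assoc, hf.eq]⟩
  have hm0 : m = 0 → c = 0 := fun h => h0 (by rw [h, zero_mul]) (by rw [h, mul_zero])
  have hn0 : n = 0 → c = 0 := fun h => h0 (by rw [h, mul_zero]) (by rw [h, zero_mul])
  have hem : c * e * m = 0 := by rw [mul_assoc, hm.1, hcm]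
  have hmf : m * (c * (1 - e)) = 0 := by
    rw [← mul_assoc, ← comm_of_mem_center hc, mul_assoc, hm.2, hcm]
  have hfn : c * (1 - e) * n = 0 := by rw [mul_assoc, hn.1, hcn]
  have hne : n * (c * e) = 0 := by
    rw [← mul_assoc, ← comm_of_mem_center hc, mul_assoc, hn.2, hcn]
  have pm := mem_peirceComponent_of_inBlock hm
  have pn := mem_peirceComponent_of_inBlock hn
  have pe := mem_peirceComponent_of_inBlock hee
  have pf := mem_peirceComponent_of_inBlock hff
  rcases hcases with (h | h) | ⟨h, h'⟩ | (⟨-, h⟩ | ⟨-, h⟩) | (⟨-, h⟩ | ⟨-, h⟩)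
  · exact hinje c hc (eq_zero_of_noNonzeroCentralIdeal h hee hce)
  · refine hinjf c hc (eq_zero_of_noNonzeroCentralIdeal h hff fun b hb => ?_)
    obtain ⟨c', hc', h'⟩ := hcf b hb
    refine ⟨c', hc', ?_⟩
    rw [← h', ← mul_assoc, ← comm_of_mem_center hc, mul_assoc, mul_assoc, hb.1, hb.2]
  -- Here (ce)(mn) = 0 and (cf)(nm) = 0. Either a factor ce or cf vanishes, which gives c = 0, or mn
  -- = nm = 0 and the obstruction is T(0).
  · rcases mul_eq_zero_of_noZeroDivisors h hee (hm.mul hn)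
      (by rw [← mul_assoc, hem, zero_mul]) with h1 | h1
    · exact hinje c hc h1
    · rcases mul_eq_zero_of_noZeroDivisors h' hff (hn.mul hm)
        (by rw [← mul_assoc, hfn, zero_mul]) with h2 | h2
      · exact hinjf c hc h2
      · exact h0 h1 h2
  · exact (h _ pe _ pm hem).elim (hinje c hc) hm0
  · exact (h _ pm _ pf hmf).elim hm0 (hinjf c hc)
  · exact (h _ pf _ pn hfn).elim (hinjf c hc) hn0
  · exact (h _ pn _ pe hne).elim hn0 (hinje c hc)

end Final

theorem mainTheorem9 {R A : Type*} [CommRing R] [Ring A] [Algebra R A]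
    (h2 : ∀ a : A, (2 : ℕ) • a = 0 → a = 0)
    (e : A) (he : IsIdempotentElem e) (he0 : e ≠ 0) (he1 : e ≠ 1)
    (hleft : PeirceLeftFaithful e (1 - e))
    (hright : PeirceRightFaithful e (1 - e))
    (hZf : CornerCenterEq he.one_sub)
    (hZe : CornerCenterEq he)
    (hcases :
      (NoNonzeroCentralIdeal he.Corner ∨ NoNonzeroCentralIdeal he.one_sub.Corner) ∨
      (NoZeroDivisors he.Corner ∧ NoZeroDivisors he.one_sub.Corner) ∨
      (PeirceStronglyFaithful e (1 - e) ∨ PeirceStronglyFaithful (1 - e) e)) :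
    HasLHDProperty R A := by
  intro L hL
  have hp : IsComplementaryPair e (1 - e) :=
    ⟨he, he.one_sub, by rw [mul_sub, mul_one, he.eq, sub_self],
      by rw [sub_mul, one_mul, he.eq, sub_self], by rw [add_sub_cancel]⟩
  have hl : ∀ a, InBlock e e a → (∀ m, InBlock e (1 - e) m → a * m = 0) → a = 0 :=
    fun a ha h => hleft a (mem_peirceComponent_of_inBlock ha) fun m hm =>
      h m (inBlock_of_mem_peirceComponent hp.1 hp.2 hm)
  have hr : ∀ b, InBlock (1 - e) (1 - e) b → (∀ m, InBlock e (1 - e) m → m * b = 0) → b = 0 :=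
    fun b hb h => hright b (mem_peirceComponent_of_inBlock hb) fun m hm =>
      h m (inBlock_of_mem_peirceComponent hp.1 hp.2 hm)
  -- On m in eAf a central z acts both as (ze)m and as m(zf), so if one corner of z is zero then z
  -- kills eAf, and faithfulness on the two sides kills both corners.
  have hinj : ∀ z ∈ Set.center A, z * e = 0 ∨ z * (1 - e) = 0 → z = 0 := by
    intro z hz h
    have hzm : ∀ m, InBlock e (1 - e) m → z * m = 0 := fun m hm => by
      rcases h with h | h
      · rw [← hm.1, ← mul_assoc, h, zero_mul]
      · rw [← hm.2, ← mul_assoc, comm_of_mem_center hz, mul_assoc, h, mul_zero]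
    have h3 : z * e = 0 := hl _
      ⟨by rw [← mul_assoc, ← comm_of_mem_center hz, mul_assoc, hp.1], by rw [mul_assoc, hp.1]⟩
      fun m hm => by rw [mul_assoc, hm.1, hzm m hm]
    have h4 : z * (1 - e) = 0 := hr _
      ⟨by rw [← mul_assoc, ← comm_of_mem_center hz, mul_assoc, hp.2], by rw [mul_assoc, hp.2]⟩
      fun m hm => by rw [← mul_assoc, ← comm_of_mem_center hz, mul_assoc, hm.2, hzm m hm]
    rw [← mul_one z, ← hp.5, mul_add, h3, h4, add_zero]
  have hinje := fun z hz h => hinj z hz (Or.inl h)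
  have hinjf := fun z hz h => hinj z hz (Or.inr h)
  have hL0 : ∀ x, PowerSeries.coeff 0 (generatingMap L x) = x := fun x => by
    rw [coeff_generatingMap, hL.1, LinearMap.id_apply]
  obtain ⟨u, v, huv, hvu, hu0, hv0, hef, hfe⟩ :=
    exists_conj_block_diagonal hp.1 hp.2 hp.3 hp.4 hp.5 (generatingMap L e) (hL0 e)
  have hΦ : IsBlockLieHom e (1 - e) (conjMap u v (generatingMap L)) := by
    refine isBlockLieHom_of_map_left h2 hp _ (fun x => ?_) (fun x y => ?_) hef hfe
    · rw [conjMap_apply, coeff_zero_mul_eq, coeff_zero_mul_eq, hu0, hv0, hL0, one_mul, mul_one]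
    · have aux : ∀ a b, u * a * v * (u * b * v) = u * (a * b) * v := fun a b => by
        calc u * a * v * (u * b * v) = u * a * (v * u) * b * v := by simp only [mul_assoc]
          _ = u * (a * b) * v := by rw [hvu, mul_one]; simp only [mul_assoc]
      rw [conjMap_apply, conjMap_apply, conjMap_apply, aux, aux, hL.generatingMap_lie, mul_sub,
        sub_mul]
  obtain ⟨D, T, hD, hDT⟩ := hΦ.exists_decomposition hp hinje hinjf
    (fun x hx hc => hZe.exists_center hx hc) (fun x hx hc => hZf.exists_center hx hc)
  have hmul := hD.map_mul hl hr fun m n hm hn => hD.obstruction_eq_zero h2 hl hr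
    (obstruction_vanishes he hinje hinjf hcases) hm hn
  -- Undoing the conjugation: vDu is still multiplicative because uv = 1, and vTu = T because T is
  -- central and vu = 1.
  refine hL.isProper (conjMap v u D) T (fun x => ?_) (fun x y => ?_) hD.central fun x => ?_
  · rw [conjMap_apply, coeff_zero_mul_eq, coeff_zero_mul_eq, hu0, hv0, hD.coeff_zero, one_mul,
      mul_one]
  · rw [conjMap_apply, conjMap_apply, conjMap_apply, hmul]
    calc v * (D x * D y) * u = v * D x * (u * v) * D y * u := by
          rw [huv, mul_one]; simp only [mul_assoc]
      _ = _ := by simp only [mul_assoc]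
  · have h5 : u * generatingMap L x * v = D x + T x := by
      rw [← conjMap_apply, hDT, LinearMap.add_apply]
    calc generatingMap L x = v * u * generatingMap L x * (v * u) := by
          rw [hvu, one_mul, mul_one]
      _ = v * (u * generatingMap L x * v) * u := by simp only [mul_assoc]
      _ = v * D x * u + T x := by
        rw [h5, mul_add, add_mul, ← comm_of_mem_center (hD.central x), mul_assoc (T x), hvu,
          mul_one]
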